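/- Let $\mathcal Z$ be a measurable space (the common space of text and audio embeddings), let $V$ be the number of classes, and let $\mathcal Y=\{e_1,\dots,e_V\}\subset\mathbb R^V$ be the set of one-hot vectors; write $|\cdot|$ for the $\ell^1$ norm on $\mathbb R^V$. Let $\mathcal H$ be a set of measurable functions $h:\mathcal Z\to\mathcal Y$ of Natarajan dimension $d<\infty$, i.e. $d$ is the largest size of a finite set $C\subset\mathcal Z$ for which there are $f_0,f_1:\mathcal Z\to\mathcal Y$ with $f_0(z)\neq f_1(z)$ for all $z\in C$, such that for every $B\subseteq C$ some $h\in\mathcal H$ equals $f_0$ on $B$ and $f_1$ on $C\setminus B$. Let $p_{\mathcal T}$ (text) and $p_{\mathcal A}$ (audio) be probability distributions on $\mathcal Z\times\mathcal Y$ with the same marginal on $\mathcal Y$. Let $N\ge 1$, let $\mathcal D_{tr}=\{(z^t_i,y_i)\}_{i=1}^N$ be drawn i.i.d. from $p_{\mathcal T}$, and put $$\widehat R_{tr}(h)=\frac1N\sum_{i=1}^N|h(z_i^t)-y_i|,\qquad R_{te}(h)=\mathbb E_{(z^a,y)\sim p_{\mathcal A}}|h(z^a)-y|.$$ For a set $G$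 of measurable functions $\mathcal Z\to\mathcal Y$ and distributions $Q_1,Q_2$ on $\mathcal Z$, the discrepancy distance is $$\mathrm{disc}_{L_1}^{G}(Q_1,Q_2)=\sup_{g,g'\in G}\bigl|\mathbb E_{Q_1}|g'-g|-\mathbb E_{Q_2}|g'-g|\bigr|.$$ For a class $v$ let $\mathcal H_v=\mathcal H\cup\{z\mapsto e_v\}$ be $\mathcal H$ together with the constant labelling function of class $v$ (so $\mathcal H_v=\mathcal H$ for all $v$ if $\mathcal H$ contains the constant classifiers). Let $\delta\in(0,1)$ and, for $h\in\mathcal H$, let $$B(h)=\widehat R_{tr}(h)+\max_{v}\,\mathrm{disc}^{\mathcal H_v}_{L_1}\bigl(p_{\mathcal A}(z^a\mid y=e_v),\,p_{\mathcal T}(z^t\mid y=e_v)\bigr)+\sqrt{\frac8N\Bigl(2d\log\sqrt{2NV}+\log\frac2\delta\Bigr)},$$ where classes of probability zero contribute $0$ to the maximum. Then: 1. For every $h\in\mathcal H$, with probability at least $1-\delta$ over $\mathcal D_{tr}$, $R_{te}(h)\le B(h)$. 2. The bound is uniform over $\mathcal H$: if the loss class of $\mathcal H$ is $p_{\mathcal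 T}$-measurable (for all $n$ and $a\in\mathbb R^n$, the function $(z_i,y_i)_{i\le n}\mapsto\sup_{h\in\mathcal H}\bigl|\sum_{i}a_i|h(z_i)-y_i|\bigr|$ is measurable for the completion of $p_{\mathcal T}^{\otimes n}$), then there is a measurable event of probability at least $1-\delta$ on which $R_{te}(h)\le B(h)$ holds for all $h\in\mathcal H$ simultaneously. -/

import Mathlib

open MeasureTheory ProbabilityTheory

noncomputable section

/-- The one-hot vector in `ℝ^V` of the class `v`. The one-hot class space is identified with
`Fin V` through this map. -/
def oneHot {V : ℕ} (v : Fin V) : Fin V → ℝ := Pi.single v 1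

/-- The `L₁` loss `|a - b|` of two one-hot labels: the `ℓ¹` norm of the difference in `ℝ^V`. -/
def l1Loss {V : ℕ} (a b : Fin V) : ℝ := ∑ j, |oneHot a j - oneHot b j|

/-- `H` Natarajan-shatters the finite set `C`: there are two labellings that differ at every point
of `C`, such that every way of mixing them over `C` is realized by a member of `H`. -/
def NatarajanShatters {Z : Type*} {V : ℕ} (H : Set (Z → Fin V)) (C : Finset Z) : Prop :=
  ∃ f₀ f₁ : Z → Fin V, (∀ z ∈ C, f₀ z ≠ f₁ z) ∧
    ∀ B : Finset Z, B ⊆ C → ∃ h ∈ H, (∀ z ∈ B, h z = f₀ z) ∧ ∀ z ∈ C, z ∉ B → h z = f₁ z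

/-- The Natarajan dimension: the largest size of a shattered finite set (possibly `⊤`). -/
def natarajanDim {Z : Type*} {V : ℕ} (H : Set (Z → Fin V)) : ℕ∞ :=
  ⨆ (C : Finset Z) (_ : NatarajanShatters H C), (C.card : ℕ∞)

/-- The expected `L₁` loss of `h` on labelled data with distribution `P`. -/
def risk {Z : Type*} [MeasurableSpace Z] {V : ℕ} (P : Measure (Z × Fin V)) (h : Z → Fin V) : ℝ :=
  ∫ p, l1Loss (h p.1) p.2 ∂P

/-- The average `L₁` loss of `h` on a sample `S` of size `N`. -/
def empRisk {Z : Type*} {V N : ℕ} (S : Fin N → Z × Fin V) (h : Z → Fin V) : ℝ :=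
  (1 / (N : ℝ)) * ∑ i, l1Loss (h (S i).1) (S i).2

/-- The class-conditional distribution of the embedding given the label `v`
(the zero measure if the class `v` has probability zero). -/
def classCond {Z : Type*} [MeasurableSpace Z] {V : ℕ} (P : Measure (Z × Fin V)) (v : Fin V) :
    Measure Z :=
  (ProbabilityTheory.cond P (Prod.snd ⁻¹' {v})).map Prod.fst

/-- The discrepancy distance, for the `L₁` loss and the set `G` of functions, of two distributions
on `Z`: the supremum over `g, g' ∈ G` of `|E_{Q₁} L₁(g', g) - E_{Q₂} L₁(g', g)|`. -/
def discL1 {Z : Type*} [MeasurableSpace Z] {V : ℕ} (G : Set (Z → Fin V)) (Q₁ Q₂ : Measure Z) : ℝ :=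
  ⨆ g : G × G, |(∫ z, l1Loss (g.2.1 z) (g.1.1 z) ∂Q₁) - ∫ z, l1Loss (g.2.1 z) (g.1.1 z) ∂Q₂|

/-- The maximum over the classes `v` of the discrepancy of the two class-conditional distributions.
Given the class `v`, the true label is the constant function `v`; the set of functions in the
discrepancy is `H` together with it (that is, just `H` if `H` contains the constants).
A class of probability zero under both distributions contributes `0`. -/
def modalityDisc {Z : Type*} [MeasurableSpace Z] {V : ℕ} (H : Set (Z → Fin V))
    (PA PT : Measure (Z × Fin V)) : ℝ :=
  ⨆ v : Fin V, discL1 (insert (fun _ => v) H) (classCond PA v) (classCond PT v)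

/-- The right-hand side of the generalization bound. -/
def genBound {Z : Type*} [MeasurableSpace Z] {V N : ℕ} (H : Set (Z → Fin V)) (d : ℕ) (δ : ℝ)
    (PA PT : Measure (Z × Fin V)) (S : Fin N → Z × Fin V) (h : Z → Fin V) : ℝ :=
  empRisk S h + modalityDisc H PA PT
    + √(8 / (N : ℝ) * (2 * (d : ℝ) * Real.log √(2 * (N : ℝ) * (V : ℝ)) + Real.log (2 / δ)))

/-- The loss class of `H` is a `P`-measurable class in the sense of empirical process theory: the
suprema `sup_h |∑ᵢ eᵢ L₁(h(zᵢ), yᵢ)|` are measurable for the completion of `Pⁿ`. -/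
def IsMeasurableClass {Z : Type*} [MeasurableSpace Z] {V : ℕ} (P : Measure (Z × Fin V))
    (H : Set (Z → Fin V)) : Prop :=
  ∀ (n : ℕ) (e : Fin n → ℝ),
    AEMeasurable (fun S : Fin n → Z × Fin V => ⨆ h : H, |∑ i, e i * l1Loss (h.1 (S i).1) (S i).2|)
      (Measure.pi fun _ : Fin n => P)

end

/-! Changing the modality and estimating the text risk are independent problems. Given the class
`v`, the loss is the `L₁` distance from `h` to the constant `v`, a pair admitted in the discrepancy
of `H_v`. The two label marginals agree, so averaging over classes gives
`risk_le_risk_add_modalityDisc`.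

For the text risk, compare the sample with a ghost sample three times as large. Jensen bounds the
exponential moment of `risk - empRisk` by that of the largest sample-ghost deviation. The i.i.d. law
is invariant under rotating each block of one sample point and its three ghosts, so one may average
over rotations with the `4N` points fixed. There Hoeffding's lemma treats one function, and
Natarajan's lemma leaves only polynomially many functions for a union bound. Markov's inequality,
applied after integrating out the ghost sample, finishes.

The factor three comes from the constants. With `k` ghosts per point the Chernoff exponent is
`4k²/(k+1)² X`, where `X = d log(2NV) + log(2/δ)`. The growth bound `(2NV)^(2d)` calls for at least
`2X`, and `k = 3` is the first to give it, with `9/4 X`. -/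

/-! ### Natarajan's lemma -/

theorem NatarajanShatters.mono {Z : Type*} {V : ℕ} {H H' : Set (Z → Fin V)} (hH : H ⊆ H')
    {C : Finset Z} (h : NatarajanShatters H C) : NatarajanShatters H' C := by
  obtain ⟨f₀, f₁, hne, hf⟩ := h
  refine ⟨f₀, f₁, hne, fun B hB => ?_⟩
  obtain ⟨h, hh, h1⟩ := hf B hB
  exact ⟨h, hH hh, h1⟩

/-- **Natarajan's lemma**: a finite set of functions that are pairwise distinct on `A` and shatter
no set of more than `d` points has at most `(|A| V (V - 1) + 1) ^ d` members. -/
theorem card_le_of_natarajanShatters_card_le {Z : Type*} {V : ℕ} (A : Finset Z) (d : ℕ)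
    (F : Finset (Z → Fin V)) (hsep : ∀ f ∈ F, ∀ g ∈ F, (∀ z ∈ A, f z = g z) → f = g)
    (hsh : ∀ C ⊆ A, NatarajanShatters (F : Set (Z → Fin V)) C → C.card ≤ d) :
    F.card ≤ (A.card * (V * (V - 1)) + 1) ^ d := by
  classical
  induction A using Finset.induction_on generalizing d F with
  | empty =>
    have : F.card ≤ 1 := Finset.card_le_one.2 fun f hf g hg => hsep f hf g hg (by simp)
    simpa using this
  | insert x A hx ih =>
    let ρ : (Z → Fin V) → (A → Fin V) := fun f z => f z
    -- `r` selects one representative in `F` for each restriction to `A`. A non-representative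
    -- agrees with its representative on `A`, hence differs from it at `x`; `G (a, b)` collects the
    -- functions for which these values at `x` are `a` and `b`.
    let r : (Z → Fin V) → (Z → Fin V) := fun f =>
      if h : ∃ g ∈ F, ρ g = ρ f then h.choose else f
    have hrF : ∀ f ∈ F, r f ∈ F ∧ ρ (r f) = ρ f := by
      intro f hf
      have h : ∃ g ∈ F, ρ g = ρ f := ⟨f, hf, rfl⟩
      simp only [r, dif_pos h]
      exact h.choose_spec
    have hrcongr : ∀ f ∈ F, ∀ g ∈ F, ρ f = ρ g → r f = r g := by
      intro f hf g hg h
      have h1 : ∃ g ∈ F, ρ g = ρ f := ⟨f, hf, rfl⟩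
      have h2 : ∃ g' ∈ F, ρ g' = ρ g := ⟨g, hg, rfl⟩
      simp only [r, dif_pos h1, dif_pos h2]
      congr 1
      ext g'
      rw [h]
    have hρ : ∀ f g : Z → Fin V, (∀ z ∈ A, f z = g z) ↔ ρ f = ρ g := fun f g =>
      ⟨fun h => funext fun z => h z z.2, fun h z hz => congrFun h ⟨z, hz⟩⟩
    let F' := F.image r
    let G : Fin V × Fin V → Finset (Z → Fin V) := fun ab =>
      F.filter fun f => r f x = ab.1 ∧ f x = ab.2
    let D : Finset (Fin V × Fin V) := Finset.univ.offDiag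
    have hcover : F ⊆ F' ∪ D.biUnion G := by
      intro f hf
      by_cases h : r f = f
      · exact Finset.mem_union_left _ (Finset.mem_image.2 ⟨f, hf, h⟩)
      · refine Finset.mem_union_right _ (Finset.mem_biUnion.2 ⟨(r f x, f x), ?_, ?_⟩)
        · simp only [D, Finset.mem_offDiag, Finset.mem_univ, true_and]
          intro hxx
          refine h (hsep _ (hrF f hf).1 f hf fun z hz => ?_)
          rcases Finset.mem_insert.1 hz with rfl | hz
          · exact hxx
          · exact (hρ _ _).2 (hrF f hf).2 z hz
        · simp [G, hf]
    have hF' : F'.card ≤ (A.card * (V * (V - 1)) + 1) ^ d := by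
      apply ih d F'
      · intro f' hf' g' hg' h
        obtain ⟨f, hf, rfl⟩ := Finset.mem_image.1 hf'
        obtain ⟨g, hg, rfl⟩ := Finset.mem_image.1 hg'
        rw [hρ, (hrF f hf).2, (hrF g hg).2] at h
        exact hrcongr f hf g hg h
      · intro C hCA hC
        refine hsh C (hCA.trans (Finset.subset_insert _ _)) (hC.mono ?_)
        intro g hg
        obtain ⟨f, hf, rfl⟩ := Finset.mem_image.1 (Finset.mem_coe.1 hg)
        exact (hrF f hf).1
    have hGF : ∀ ab f, f ∈ G ab → f ∈ F ∧ r f x = ab.1 ∧ f x = ab.2 := fun ab f hf => by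
      simpa [G] using hf
    -- Each `h` in `G (a, b)` brings along `r h`: both lie in `F`, agree on `C`, and take the values
    -- `b` and `a` at `x`. So `F` shatters `C` enlarged by `x`, and the dimension drops by one.
    have hGsh : ∀ ab ∈ D, ∀ C ⊆ A, NatarajanShatters (G ab : Set (Z → Fin V)) C →
        C.card + 1 ≤ d := by
      rintro ⟨a, b⟩ hab C hCA ⟨f₀, f₁, hne, hf⟩
      have hab : a ≠ b := by simpa [D] using hab
      have hxC : x ∉ C := fun h => hx (hCA h)
      have hzx : ∀ z ∈ C, z ≠ x := fun z hz h => hxC (h ▸ hz)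
      rw [← Finset.card_insert_of_notMem hxC]
      refine hsh _ (Finset.insert_subset_insert x hCA)
        ⟨Function.update f₀ x a, Function.update f₁ x b, ?_, ?_⟩
      · intro z hz
        rcases Finset.mem_insert.1 hz with rfl | hz
        · simpa using hab
        · simpa [hzx z hz] using hne z hz
      · intro B hB
        obtain ⟨h, hhG, h0, h1⟩ := hf (B.erase x) (by
          intro z hz
          obtain ⟨hz1, hz2⟩ := Finset.mem_erase.1 hz
          exact Finset.mem_of_mem_insert_of_ne (hB hz2) hz1)
        obtain ⟨hhF, hra, hb⟩ := hGF _ h hhG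
        have hrh := (hρ _ _).2 (hrF h hhF).2
        by_cases hxB : x ∈ B
        · refine ⟨r h, (hrF h hhF).1, fun z hz => ?_, fun z hz hzB => ?_⟩
          · rcases Finset.mem_insert.1 (hB hz) with rfl | hzC
            · simpa using hra
            · rw [Function.update_of_ne (hzx z hzC), hrh z (hCA hzC),
                h0 z (Finset.mem_erase.2 ⟨hzx z hzC, hz⟩)]
          · rcases Finset.mem_insert.1 hz with rfl | hzC
            · exact absurd hxB hzB
            · rw [Function.update_of_ne (hzx z hzC), hrh z (hCA hzC),
                h1 z hzC fun hz' => hzB (Finset.mem_of_mem_erase hz')]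
        · refine ⟨h, hhF, fun z hz => ?_, fun z hz hzB => ?_⟩
          · have hzx' : z ≠ x := fun h => hxB (h ▸ hz)
            rw [Function.update_of_ne hzx', h0 z (Finset.mem_erase.2 ⟨hzx', hz⟩)]
          · rcases Finset.mem_insert.1 hz with rfl | hzC
            · simpa using hb
            · rw [Function.update_of_ne (hzx z hzC),
                h1 z hzC fun hz' => hzB (Finset.mem_of_mem_erase hz')]
    have hDcard : D.card = V * (V - 1) := by
      simp [D, Finset.offDiag_card, Nat.mul_sub]
    have hcard : F.card ≤ F'.card + ∑ ab ∈ D, (G ab).card :=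
      (Finset.card_le_card hcover).trans
        ((Finset.card_union_le _ _).trans (Nat.add_le_add_left Finset.card_biUnion_le _))
    rw [Finset.card_insert_of_notMem hx, ← hDcard]
    rw [← hDcard] at hF' ih
    rcases d with _ | d
    -- For `d = 0` every `G ab` is empty, since any nonempty class shatters `∅`.
    · have : ∑ ab ∈ D, (G ab).card = 0 := Finset.sum_eq_zero fun ab hab => by
        by_contra hne
        obtain ⟨f, hf⟩ := Finset.card_pos.1 (Nat.pos_of_ne_zero hne)
        have := hGsh ab hab ∅ (by simp) ⟨f, f, by simp, fun B hB => ⟨f, hf, by simp⟩⟩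
        omega
      simpa [this] using hcard.trans (Nat.add_le_add_right hF' _)
    · have hG : ∀ ab ∈ D, (G ab).card ≤ (A.card * D.card + 1) ^ d := by
        intro ab hab
        refine ih d (G ab) (fun f hf g hg h => ?_) fun C hCA hC => by
          have := hGsh ab hab C hCA hC
          omega
        obtain ⟨hfF, -, hfb⟩ := hGF _ f hf
        obtain ⟨hgF, -, hgb⟩ := hGF _ g hg
        refine hsep f hfF g hgF fun z hz => ?_
        rcases Finset.mem_insert.1 hz with rfl | hz
        · rw [hfb, hgb]
        · exact h z hz
      calc F.card ≤ (A.card * D.card + 1) ^ (d + 1) + D.card * (A.card * D.card + 1) ^ d :=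
            hcard.trans (Nat.add_le_add hF' (by
              simpa using Finset.sum_le_card_nsmul D _ _ hG))
        _ = ((A.card + 1) * D.card + 1) * (A.card * D.card + 1) ^ d := by ring
        _ ≤ ((A.card + 1) * D.card + 1) * ((A.card + 1) * D.card + 1) ^ d := by gcongr; omega
        _ = ((A.card + 1) * D.card + 1) ^ (d + 1) := by ring

/-- A class has finitely many representatives that realize all its restrictions to a finite set. -/
theorem exists_finset_restrict_eq {Z : Type*} {V : ℕ} (H : Set (Z → Fin V)) (A : Finset Z) :
    ∃ F : Finset (Z → Fin V), (F : Set (Z → Fin V)) ⊆ H ∧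
      (∀ f ∈ F, ∀ g ∈ F, (∀ z ∈ A, f z = g z) → f = g) ∧
      ∀ h ∈ H, ∃ f ∈ F, ∀ z ∈ A, h z = f z := by
  classical
  let ρ : (Z → Fin V) → (A → Fin V) := fun f z => f z
  have hρ : ∀ f g : Z → Fin V, (∀ z ∈ A, f z = g z) ↔ ρ f = ρ g := fun f g =>
    ⟨fun h => funext fun z => h z z.2, fun h z hz => congrFun h ⟨z, hz⟩⟩
  obtain ⟨s, hsH, hs⟩ := Set.exists_subset_bijOn H ρ
  have hfin : s.Finite := Set.Finite.of_finite_image (Set.toFinite _) hs.injOn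
  refine ⟨hfin.toFinset, by simpa using hsH, fun f hf g hg h => ?_, fun h hh => ?_⟩
  · exact hs.injOn (hfin.mem_toFinset.1 hf) (hfin.mem_toFinset.1 hg) ((hρ f g).1 h)
  · obtain ⟨f, hf, hfh⟩ := hs.surjOn (Set.mem_image_of_mem ρ hh)
    exact ⟨f, hfin.mem_toFinset.2 hf, (hρ h f).2 hfh.symm⟩

/-! ### The loss and the change of modality -/

theorem l1Loss_nonneg {V : ℕ} (a b : Fin V) : 0 ≤ l1Loss a b :=
  Finset.sum_nonneg fun _ _ => abs_nonneg _

theorem l1Loss_le_two {V : ℕ} (a b : Fin V) : l1Loss a b ≤ 2 := by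
  have h : ∀ c : Fin V, ∑ j, |oneHot c j| = 1 := fun c => by
    simp [oneHot, Pi.single_apply, apply_ite abs]
  calc l1Loss a b ≤ ∑ j, (|oneHot a j| + |oneHot b j|) :=
        Finset.sum_le_sum fun j _ => abs_sub _ _
    _ = 2 := by rw [Finset.sum_add_distrib, h, h]; norm_num

theorem measurable_l1Loss {Z : Type*} [MeasurableSpace Z] {V : ℕ} {h : Z → Fin V}
    (hh : Measurable h) : Measurable fun p : Z × Fin V => l1Loss (h p.1) p.2 :=
  (Measurable.of_discrete (f := fun q : Fin V × Fin V => l1Loss q.1 q.2)).comp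
    ((hh.comp measurable_fst).prodMk measurable_snd)

theorem integrable_l1Loss {Z : Type*} [MeasurableSpace Z] {V : ℕ} (P : Measure (Z × Fin V))
    [IsFiniteMeasure P] {h : Z → Fin V} (hh : Measurable h) :
    Integrable (fun p : Z × Fin V => l1Loss (h p.1) p.2) P :=
  .of_bound (measurable_l1Loss hh).aestronglyMeasurable 2 (.of_forall fun p => by
    rw [Real.norm_eq_abs, abs_of_nonneg (l1Loss_nonneg _ _)]; exact l1Loss_le_two _ _)

/-- The risk is the mixture of the class-conditional losses. -/
theorem risk_eq_sum_classCond {Z : Type*} [MeasurableSpace Z] {V : ℕ} (P : Measure (Z × Fin V))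
    [IsFiniteMeasure P] {h : Z → Fin V} (hh : Measurable h) :
    risk P h = ∑ v, (P.map Prod.snd).real {v} * ∫ z, l1Loss (h z) v ∂classCond P v := by
  have hA : ∀ v : Fin V, MeasurableSet (Prod.snd ⁻¹' {v} : Set (Z × Fin V)) := fun v =>
    measurable_snd (measurableSet_singleton v)
  have hU : (⋃ v : Fin V, (Prod.snd ⁻¹' {v} : Set (Z × Fin V))) = Set.univ := by ext; simp
  rw [risk, ← setIntegral_univ, ← hU, integral_iUnion_fintype hA
    (fun v w hvw => Set.disjoint_left.2 fun p h1 h2 => hvw (by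
      rw [← Set.mem_singleton_iff.1 h1, ← Set.mem_singleton_iff.1 h2]))
    fun v => (integrable_l1Loss P hh).integrableOn]
  refine Finset.sum_congr rfl fun v _ => ?_
  have hm : Measurable fun z => l1Loss (h z) v :=
    (Measurable.of_discrete (f := fun a : Fin V => l1Loss a v)).comp hh
  rw [setIntegral_congr_fun (g := fun p : Z × Fin V => l1Loss (h p.1) v) (hA v)
    fun p hp => by simp [Set.mem_singleton_iff.1 hp], classCond,
    integral_map measurable_fst.aemeasurable hm.aestronglyMeasurable,
    map_measureReal_apply measurable_snd (measurableSet_singleton v), ProbabilityTheory.cond,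
    integral_smul_measure, smul_eq_mul, ENNReal.toReal_inv, Measure.real]
  -- Conditioning on a null class gives the zero measure, and then both sides vanish.
  by_cases h0 : P (Prod.snd ⁻¹' {v}) = 0
  · rw [Measure.restrict_eq_zero.2 h0]; simp
  · rw [mul_inv_cancel_left₀ (ENNReal.toReal_ne_zero.2 ⟨h0, measure_ne_top _ _⟩)]

theorem isFiniteMeasure_classCond {Z : Type*} [MeasurableSpace Z] {V : ℕ}
    (P : Measure (Z × Fin V)) [IsFiniteMeasure P] (v : Fin V) :
    IsFiniteMeasure (classCond P v) := by
  unfold classCond; infer_instance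

theorem abs_integral_sub_le_discL1 {Z : Type*} [MeasurableSpace Z] {V : ℕ} {G : Set (Z → Fin V)}
    (Q₁ Q₂ : Measure Z) [IsFiniteMeasure Q₁] [IsFiniteMeasure Q₂] {g g' : Z → Fin V} (hg : g ∈ G)
    (hg' : g' ∈ G) :
    |(∫ z, l1Loss (g' z) (g z) ∂Q₁) - ∫ z, l1Loss (g' z) (g z) ∂Q₂| ≤ discL1 G Q₁ Q₂ := by
  have hb : ∀ (Q : Measure Z) [IsFiniteMeasure Q] (g g' : Z → Fin V),
      |∫ z, l1Loss (g' z) (g z) ∂Q| ≤ 2 * Q.real Set.univ := fun Q _ g g' => by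
    refine norm_integral_le_of_norm_le_const (μ := Q) (f := fun z => l1Loss (g' z) (g z))
      (.of_forall fun z => ?_)
    rw [Real.norm_eq_abs, abs_of_nonneg (l1Loss_nonneg _ _)]
    exact l1Loss_le_two _ _
  -- A real supremum is `0` when unbounded, so an explicit upper bound is needed; the loss being at
  -- most `2` supplies it.
  refine le_ciSup (f := fun g : G × G =>
    |(∫ z, l1Loss (g.2.1 z) (g.1.1 z) ∂Q₁) - ∫ z, l1Loss (g.2.1 z) (g.1.1 z) ∂Q₂|)
    ⟨2 * Q₁.real Set.univ + 2 * Q₂.real Set.univ, ?_⟩ (⟨g, hg⟩, ⟨g', hg'⟩)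
  rintro _ ⟨⟨g, g'⟩, rfl⟩
  exact (abs_sub _ _).trans (add_le_add (hb Q₁ g.1 g'.1) (hb Q₂ g.1 g'.1))

/-- Changing the modality costs at most the largest class-conditional discrepancy. -/
theorem risk_le_risk_add_modalityDisc {Z : Type*} [MeasurableSpace Z] {V : ℕ}
    {H : Set (Z → Fin V)} (PT PA : Measure (Z × Fin V)) [IsProbabilityMeasure PT]
    [IsProbabilityMeasure PA] (hclass : PA.map Prod.snd = PT.map Prod.snd) {h : Z → Fin V}
    (hH : h ∈ H) (hh : Measurable h) : risk PA h ≤ risk PT h + modalityDisc H PA PT := by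
  have := isFiniteMeasure_classCond PA
  have := isFiniteMeasure_classCond PT
  have : IsProbabilityMeasure (PT.map Prod.snd) :=
    Measure.isProbabilityMeasure_map measurable_snd.aemeasurable
  have hsum : ∑ v, (PT.map Prod.snd).real {v} = 1 := by
    rw [sum_measureReal_singleton]; simp
  rw [← sub_le_iff_le_add', risk_eq_sum_classCond PA hh, risk_eq_sum_classCond PT hh, hclass,
    ← Finset.sum_sub_distrib]
  calc _ ≤ ∑ v, (PT.map Prod.snd).real {v} * modalityDisc H PA PT := by
        refine Finset.sum_le_sum fun v _ => ?_
        rw [← mul_sub]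
        refine mul_le_mul_of_nonneg_left ((le_abs_self _).trans ?_) measureReal_nonneg
        exact (abs_integral_sub_le_discL1 _ _ (Set.mem_insert _ H)
          (Set.mem_insert_of_mem _ hH)).trans
          (le_ciSup (f := fun v : Fin V => discL1 (insert (fun _ => v) H) (classCond PA v)
            (classCond PT v)) (Set.finite_range _).bddAbove v)
    _ = modalityDisc H PA PT := by rw [← Finset.sum_mul, hsum, one_mul]

/-! ### Exponential moments under random block rotations -/

/-- **Hoeffding's lemma** for the uniform distribution on a finite type. -/
theorem sum_exp_mul_le_of_sum_eq_zero {κ : Type*} [Fintype κ] [Nonempty κ] (x : κ → ℝ) {a b : ℝ}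
    (hx : ∀ s, x s ∈ Set.Icc a b) (h0 : ∑ s, x s = 0) (t : ℝ) :
    ∑ s, Real.exp (t * x s) ≤ Fintype.card κ * Real.exp (t ^ 2 * (b - a) ^ 2 / 8) := by
  let _ : MeasurableSpace κ := ⊤
  have : DiscreteMeasurableSpace κ := ⟨fun _ => trivial⟩
  let μ : Measure κ := uniformOn Set.univ
  have hμ : ∀ s, μ.real {s} = (Fintype.card κ : ℝ)⁻¹ := fun s => by
    simp [μ, Measure.real, uniformOn_univ]
  have hint : ∀ f : κ → ℝ, ∫ s, f s ∂μ = (Fintype.card κ : ℝ)⁻¹ * ∑ s, f s := fun f => by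
    rw [integral_fintype .of_finite, Finset.mul_sum]
    simp [hμ]
  have hsub := hasSubgaussianMGF_of_mem_Icc_of_integral_eq_zero (μ := μ) (X := x)
    (Measurable.of_discrete.aemeasurable) (.of_forall hx) (by rw [hint, h0, mul_zero])
  have h := hsub.mgf_le t
  have hc : (0 : ℝ) < Fintype.card κ := by exact_mod_cast Fintype.card_pos
  rw [mgf, hint, inv_mul_le_iff₀ hc] at h
  refine h.trans_eq ?_
  congr 2
  simp only [NNReal.coe_pow, NNReal.coe_div, coe_nnnorm, NNReal.coe_ofNat, div_pow,
    Real.norm_eq_abs, sq_abs]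
  ring

/-- The coefficients of the difference between the mean over the ghost sample (columns `1, 2, 3`)
and the mean over the sample (column `0`). -/
noncomputable def ghostWeight (N : ℕ) (q : Fin N × Fin 4) : ℝ := if q.2 = 0 then -(1 / N) else 1 / (3 * N)

/-- The action of a family of rotations, one for each block `{i} × Fin 4`. -/
def blockRotation {N : ℕ} (σ : Fin N → Fin 4) : Fin N × Fin 4 ≃ Fin N × Fin 4 where
  toFun q := (q.1, q.2 + σ q.1)
  invFun q := (q.1, q.2 - σ q.1)
  left_inv q := by simp
  right_inv q := by simp

/-- Independent uniform rotations make the block contributions independent and centred, so the sum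
over `σ` factors and Hoeffding's lemma applies to each block. -/
theorem sum_exp_ghostWeight_blockRotation_le {N : ℕ} (hN : 0 < N) (l : Fin N × Fin 4 → ℝ)
    (hl : ∀ q, l q ∈ Set.Icc (0 : ℝ) 2) (t : ℝ) :
    ∑ σ : Fin N → Fin 4, Real.exp (t * ∑ q, ghostWeight N q * l (blockRotation σ q)) ≤
      4 ^ N * Real.exp (8 * t ^ 2 / (9 * N)) := by
  have hN' : (0 : ℝ) < N := by exact_mod_cast hN
  -- The contribution of block `i` when entry `s` is rotated into the sample column: the mean of the
  -- other three minus `l (i, s)`, over `N`. As `s` varies it sums to zero and stays in an interval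
  -- of length `8 / (3N)`.
  let x : Fin N → Fin 4 → ℝ := fun i s => ((∑ j, l (i, j)) - 4 * l (i, s)) / (3 * N)
  have hx : ∀ (σ : Fin N → Fin 4), ∑ q, ghostWeight N q * l (blockRotation σ q) =
      ∑ i, x i (σ i) := by
    intro σ
    rw [Fintype.sum_prod_type]
    refine Finset.sum_congr rfl fun i _ => ?_
    have h1 : ∑ j, l (i, j) = ∑ j, l (i, j + σ i) :=
      (Equiv.sum_comp (Equiv.addRight (σ i)) fun j => l (i, j)).symm
    simp only [x]
    rw [h1]
    simp only [Fin.sum_univ_four, ghostWeight, blockRotation, Equiv.coe_fn_mk]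
    simp
    field_simp
    ring
  have hprod : ∑ σ : Fin N → Fin 4, Real.exp (t * ∑ i, x i (σ i)) =
      ∏ i, ∑ s, Real.exp (t * x i s) := by
    rw [Finset.prod_univ_sum, Fintype.piFinset_univ]
    simp_rw [Finset.mul_sum, Real.exp_sum]
  simp_rw [hx]
  rw [hprod]
  have hblock : ∀ i, ∑ s, Real.exp (t * x i s) ≤
      4 * Real.exp (t ^ 2 * (8 / (3 * N)) ^ 2 / 8) := by
    intro i
    have := sum_exp_mul_le_of_sum_eq_zero (x i) (a := ((∑ j, l (i, j)) - 8) / (3 * N))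
      (b := (∑ j, l (i, j)) / (3 * N)) (fun s => ?_) ?_ t
    · refine this.trans_eq ?_
      rw [Fintype.card_fin]
      rw [← sub_div, sub_sub_cancel, Nat.cast_ofNat]
    · have := hl (i, s)
      constructor <;> simp only [x] <;> gcongr <;> linarith [this.1, this.2]
    · simp only [x, ← Finset.sum_div, Finset.sum_sub_distrib, ← Finset.mul_sum]
      simp
  calc _ ≤ ∏ i : Fin N, 4 * Real.exp (t ^ 2 * (8 / (3 * N)) ^ 2 / 8) :=
        Finset.prod_le_prod (fun i _ => Finset.sum_nonneg fun _ _ => (Real.exp_pos _).le)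
          fun i _ => hblock i
    _ = 4 ^ N * Real.exp (8 * t ^ 2 / (9 * N)) := by
      rw [Finset.prod_const, Finset.card_univ, Fintype.card_fin, mul_pow, ← Real.exp_nat_mul]
      congr 2
      field_simp
      ring

/-- The mean loss of `h` on the ghost sample minus that on the sample. -/
noncomputable def ghostDev {Z : Type*} {V N : ℕ} (S : Fin N × Fin 4 → Z × Fin V) (h : Z → Fin V) : ℝ :=
  ∑ q, ghostWeight N q * l1Loss (h (S q).1) (S q).2

/-- The largest deviation between sample and ghost sample over a class. -/
noncomputable def supGhostDev {Z : Type*} {V N : ℕ} (H : Set (Z → Fin V)) (S : Fin N × Fin 4 → Z × Fin V) : ℝ :=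
  ⨆ h : H, |ghostDev S h.1|

theorem abs_ghostDev_le_supGhostDev {Z : Type*} {V N : ℕ} {H : Set (Z → Fin V)}
    (S : Fin N × Fin 4 → Z × Fin V) {h : Z → Fin V} (hh : h ∈ H) :
    |ghostDev S h| ≤ supGhostDev H S := by
  refine le_ciSup (f := fun h : H => |ghostDev S h.1|) ⟨∑ q, |ghostWeight N q| * 2, ?_⟩ ⟨h, hh⟩
  rintro _ ⟨h, rfl⟩
  refine (Finset.abs_sum_le_sum_abs _ _).trans (Finset.sum_le_sum fun q _ => ?_)
  rw [abs_mul, abs_of_nonneg (l1Loss_nonneg _ _)]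
  exact mul_le_mul_of_nonneg_left (l1Loss_le_two _ _) (abs_nonneg _)

/-- Rotations permute a fixed set of at most `4N` points, so one finite set of representatives
serves all `σ`. The exponential of the maximum is at most the sum over representatives and both
signs, whence the factor `2`. -/
theorem sum_exp_supGhostDev_blockRotation_le {Z : Type*} {V N d : ℕ} (hN : 0 < N)
    {H : Set (Z → Fin V)} (hne : H.Nonempty) (hdim : ∀ C, NatarajanShatters H C → C.card ≤ d)
    (S : Fin N × Fin 4 → Z × Fin V) {t : ℝ} (ht : 0 ≤ t) :
    ∑ σ : Fin N → Fin 4, Real.exp (t * supGhostDev H (S ∘ blockRotation σ)) ≤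
      4 ^ N * (2 * (4 * N * (V * (V - 1) : ℕ) + 1) ^ d * Real.exp (8 * t ^ 2 / (9 * N))) := by
  classical
  have : Nonempty H := hne.to_subtype
  let A : Finset Z := Finset.univ.image fun q => (S q).1
  have hA : A.card ≤ 4 * N := Finset.card_image_le.trans (by simp [mul_comm])
  have hmem : ∀ q, (S q).1 ∈ A := fun q => Finset.mem_image_of_mem _ (Finset.mem_univ q)
  obtain ⟨F, hFH, hsep, hF⟩ := exists_finset_restrict_eq H A
  have hcard : (F.card : ℝ) ≤ (4 * N * (V * (V - 1) : ℕ) + 1) ^ d := by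
    have := card_le_of_natarajanShatters_card_le A d F hsep fun C _ hC => hdim C (hC.mono hFH)
    have h2 : F.card ≤ (4 * N * (V * (V - 1)) + 1) ^ d := this.trans (by gcongr)
    exact_mod_cast h2
  have hFne : F.Nonempty := by
    obtain ⟨h, hh⟩ := hne
    obtain ⟨f, hf, -⟩ := hF h hh
    exact ⟨f, hf⟩
  have hpt : ∀ σ : Fin N → Fin 4, Real.exp (t * supGhostDev H (S ∘ blockRotation σ)) ≤
      ∑ f ∈ F, (Real.exp (t * ghostDev (S ∘ blockRotation σ) f) +
        Real.exp (-t * ghostDev (S ∘ blockRotation σ) f)) := by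
    intro σ
    obtain ⟨f, hf, hmax⟩ := F.exists_max_image (fun f => |ghostDev (S ∘ blockRotation σ) f|) hFne
    have hsup : supGhostDev H (S ∘ blockRotation σ) ≤ |ghostDev (S ∘ blockRotation σ) f| := by
      refine ciSup_le fun h => ?_
      obtain ⟨g, hg, hgh⟩ := hF h.1 h.2
      refine le_trans (le_of_eq ?_) (hmax g hg)
      simp only [ghostDev, Function.comp_apply, hgh _ (hmem _)]
    calc _ ≤ Real.exp (t * |ghostDev (S ∘ blockRotation σ) f|) := by gcongr
      _ ≤ Real.exp (t * ghostDev (S ∘ blockRotation σ) f) +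
          Real.exp (-t * ghostDev (S ∘ blockRotation σ) f) := by
        rcases abs_cases (ghostDev (S ∘ blockRotation σ) f) with ⟨h, -⟩ | ⟨h, -⟩ <;> rw [h]
        · exact le_add_of_nonneg_right (Real.exp_pos _).le
        · rw [mul_neg, ← neg_mul]
          exact le_add_of_nonneg_left (Real.exp_pos _).le
      _ ≤ _ := Finset.single_le_sum (f := fun f =>
          Real.exp (t * ghostDev (S ∘ blockRotation σ) f) +
          Real.exp (-t * ghostDev (S ∘ blockRotation σ) f)) (fun _ _ => by positivity) hf
  have hone : ∀ (f : Z → Fin V) (t : ℝ),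
      ∑ σ : Fin N → Fin 4, Real.exp (t * ghostDev (S ∘ blockRotation σ) f) ≤
        4 ^ N * Real.exp (8 * t ^ 2 / (9 * N)) := fun f t =>
    sum_exp_ghostWeight_blockRotation_le hN (fun q => l1Loss (f (S q).1) (S q).2)
      (fun q => ⟨l1Loss_nonneg _ _, l1Loss_le_two _ _⟩) t
  calc _ ≤ ∑ σ : Fin N → Fin 4, ∑ f ∈ F, (Real.exp (t * ghostDev (S ∘ blockRotation σ) f) +
        Real.exp (-t * ghostDev (S ∘ blockRotation σ) f)) := Finset.sum_le_sum fun σ _ => hpt σ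
    _ ≤ ∑ f ∈ F, 2 * (4 ^ N * Real.exp (8 * t ^ 2 / (9 * N))) := by
      rw [Finset.sum_comm]
      refine Finset.sum_le_sum fun f _ => ?_
      rw [Finset.sum_add_distrib, two_mul]
      have := hone f (-t)
      rw [neg_sq] at this
      exact add_le_add (hone f t) this
    _ = F.card * (2 * (4 ^ N * Real.exp (8 * t ^ 2 / (9 * N)))) := by
      rw [Finset.sum_const, nsmul_eq_mul]
    _ ≤ (4 * N * (V * (V - 1) : ℕ) + 1) ^ d * (2 * (4 ^ N * Real.exp (8 * t ^ 2 / (9 * N)))) := by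
      gcongr
    _ = _ := by ring

/-! ### Symmetrization with a ghost sample -/

/-- Relabelling the coordinates preserves the distribution of an i.i.d. sample. -/
theorem measurePreserving_pi_comp_equiv {Ω ι κ : Type*} [Fintype ι] [Fintype κ]
    [MeasurableSpace Ω] (P : Measure Ω) [SigmaFinite P] (e : ι ≃ κ) :
    MeasurePreserving (fun S : κ → Ω => S ∘ e) (Measure.pi fun _ => P)
      (Measure.pi fun _ => P) := by
  have hm : Measurable fun S : κ → Ω => S ∘ e :=
    measurable_pi_lambda _ fun i => measurable_pi_apply (e i)
  refine ⟨hm, (Measure.pi_eq fun s hs => ?_).symm⟩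
  rw [Measure.map_apply hm (.univ_pi hs)]
  have : (fun S : κ → Ω => S ∘ e) ⁻¹' Set.univ.pi s = Set.univ.pi fun k => s (e.symm k) := by
    ext S
    simp only [Set.mem_preimage, Set.mem_pi, Set.mem_univ, true_imp_iff, Function.comp_apply]
    exact ⟨fun h k => by simpa using h (e.symm k), fun h i => by simpa using h (e i)⟩
  rw [this, Measure.pi_pi, ← Equiv.prod_comp e]
  simp

/-- The sample `S` in column `0`, and the ghost sample `T` in the columns `1, 2, 3`. -/
def glueSample {Ω : Type*} {N : ℕ} (p : (Fin N → Ω) × (Fin N × Fin 3 → Ω)) :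
    Fin N × Fin 4 → Ω :=
  fun q => Fin.cons (α := fun _ => Ω) (p.1 q.1) (fun j => p.2 (q.1, j)) q.2

theorem measurePreserving_glueSample {Ω : Type*} [MeasurableSpace Ω] (P : Measure Ω)
    [SigmaFinite P] (N : ℕ) :
    MeasurePreserving (glueSample (Ω := Ω) (N := N))
      ((Measure.pi fun _ => P).prod (Measure.pi fun _ => P)) (Measure.pi fun _ => P) := by
  have hm : Measurable (glueSample (Ω := Ω) (N := N)) := by
    refine measurable_pi_lambda _ ?_
    rintro ⟨i, j⟩
    refine Fin.cases ?_ (fun j => ?_) j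
    · exact (measurable_pi_apply i).comp measurable_fst
    · exact (measurable_pi_apply (i, j)).comp measurable_snd
  refine ⟨hm, (Measure.pi_eq fun s hs => ?_).symm⟩
  rw [Measure.map_apply hm (.univ_pi hs)]
  have : glueSample ⁻¹' Set.univ.pi s =
      (Set.univ.pi fun i : Fin N => s (i, 0)) ×ˢ
        Set.univ.pi fun q : Fin N × Fin 3 => s (q.1, q.2.succ) := by
    ext p
    simp only [Set.mem_preimage, Set.mem_pi, Set.mem_univ, true_imp_iff, Prod.forall,
      Set.mem_prod, Fin.forall_fin_succ (n := 3), glueSample, Fin.cons_zero, Fin.cons_succ,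
      forall_and]
  rw [this, Measure.prod_prod, Measure.pi_pi, Measure.pi_pi, Fintype.prod_prod_type,
    Fintype.prod_prod_type, ← Finset.prod_mul_distrib]
  exact Finset.prod_congr rfl fun i _ => (Fin.prod_univ_succ fun j => P (s (i, j))).symm

theorem aemeasurable_supGhostDev {Z : Type*} [MeasurableSpace Z] {V N : ℕ}
    {P : Measure (Z × Fin V)} [SigmaFinite P] {H : Set (Z → Fin V)} (hH : IsMeasurableClass P H) :
    AEMeasurable (supGhostDev (N := N) H) (Measure.pi fun _ => P) := by
  let e : Fin (N * 4) ≃ Fin N × Fin 4 := finProdFinEquiv.symm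
  have h := (hH (N * 4) fun i => ghostWeight N (e i)).comp_quasiMeasurePreserving
    (measurePreserving_pi_comp_equiv P e).quasiMeasurePreserving
  convert h using 1
  ext S
  simp only [supGhostDev, ghostDev, Function.comp_apply]
  refine iSup_congr fun h => ?_
  rw [← Equiv.sum_comp e]

/-- Every rotation preserves the product law, so the integral equals its average over the `4 ^ N`
rotations, which is bounded pointwise in the sample. -/
theorem lintegral_exp_supGhostDev_le {Z : Type*} [MeasurableSpace Z] {V N d : ℕ} (hN : 0 < N)
    {H : Set (Z → Fin V)} (hne : H.Nonempty) (hdim : ∀ C, NatarajanShatters H C → C.card ≤ d)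
    {P : Measure (Z × Fin V)} [IsProbabilityMeasure P] (hH : IsMeasurableClass P H) {t : ℝ}
    (ht : 0 ≤ t) :
    ∫⁻ S, ENNReal.ofReal (Real.exp (t * supGhostDev (N := N) H S)) ∂(Measure.pi fun _ => P) ≤
      ENNReal.ofReal
        (2 * (4 * N * (V * (V - 1) : ℕ) + 1) ^ d * Real.exp (8 * t ^ 2 / (9 * N))) := by
  let f : (Fin N × Fin 4 → Z × Fin V) → ENNReal := fun S =>
    ENNReal.ofReal (Real.exp (t * supGhostDev H S))
  let μ : Measure (Fin N × Fin 4 → Z × Fin V) := Measure.pi fun _ => P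
  have hf : AEMeasurable f μ :=
    (Real.measurable_exp.comp_aemeasurable
      ((aemeasurable_supGhostDev hH).const_mul t)).ennreal_ofReal
  have hmp : ∀ σ : Fin N → Fin 4, MeasurePreserving
      (fun S : Fin N × Fin 4 → Z × Fin V => S ∘ blockRotation σ) μ μ := fun σ =>
    measurePreserving_pi_comp_equiv P (blockRotation σ)
  have hrot : ∀ σ : Fin N → Fin 4, ∫⁻ S, f (S ∘ blockRotation σ) ∂μ = ∫⁻ S, f S ∂μ := fun σ => by
    have h1 := hmp σ
    have h2 : AEMeasurable f (μ.map fun S => S ∘ blockRotation σ) := by rwa [h1.map_eq]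
    rw [← lintegral_map' h2 h1.aemeasurable, h1.map_eq]
  have key : (4 ^ N : ENNReal) * ∫⁻ S, f S ∂μ ≤ 4 ^ N * ENNReal.ofReal
      (2 * (4 * N * (V * (V - 1) : ℕ) + 1) ^ d * Real.exp (8 * t ^ 2 / (9 * N))) := by
    calc (4 ^ N : ENNReal) * ∫⁻ S, f S ∂μ
        = ∑ σ : Fin N → Fin 4, ∫⁻ S, f (S ∘ blockRotation σ) ∂μ := by simp [hrot]
      _ = ∫⁻ S, ∑ σ : Fin N → Fin 4, f (S ∘ blockRotation σ) ∂μ :=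
        (lintegral_finsetSum' _ fun σ _ => hf.comp_quasiMeasurePreserving (hmp σ).quasiMeasurePreserving).symm
      _ ≤ ∫⁻ _, 4 ^ N * ENNReal.ofReal
          (2 * (4 * N * (V * (V - 1) : ℕ) + 1) ^ d * Real.exp (8 * t ^ 2 / (9 * N))) ∂μ := by
        refine lintegral_mono fun S => ?_
        rw [← ENNReal.ofReal_sum_of_nonneg fun _ _ => (Real.exp_pos _).le]
        refine (ENNReal.ofReal_le_ofReal
          (sum_exp_supGhostDev_blockRotation_le hN hne hdim S ht)).trans_eq ?_
        rw [ENNReal.ofReal_mul (by positivity), ENNReal.ofReal_pow (by norm_num)]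
        norm_num
      _ = _ := by rw [lintegral_const]; simp [μ]
  exact (ENNReal.mul_le_mul_iff_right (by simp) (by simp)).1 key

theorem ghostDev_glueSample {Z : Type*} {V N : ℕ} (S : Fin N → Z × Fin V)
    (T : Fin N × Fin 3 → Z × Fin V) (h : Z → Fin V) :
    ghostDev (glueSample (S, T)) h =
      1 / (3 * N) * ∑ q, l1Loss (h (T q).1) (T q).2 - empRisk S h := by
  rw [ghostDev, empRisk, Fintype.sum_prod_type, Fintype.sum_prod_type, Finset.mul_sum,
    Finset.mul_sum, ← Finset.sum_sub_distrib]
  refine Finset.sum_congr rfl fun i _ => ?_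
  rw [Fin.sum_univ_succ, Finset.mul_sum]
  simp [ghostWeight, glueSample]
  ring

/-- Jensen's inequality over the ghost sample. -/
theorem exp_risk_sub_empRisk_le {Z : Type*} [MeasurableSpace Z] {V N : ℕ} (hN : 0 < N)
    {H : Set (Z → Fin V)} {P : Measure (Z × Fin V)} [IsProbabilityMeasure P] {h : Z → Fin V}
    (hh : h ∈ H) (hm : Measurable h) (S : Fin N → Z × Fin V) {t : ℝ} (ht : 0 ≤ t) :
    ENNReal.ofReal (Real.exp (t * (risk P h - empRisk S h))) ≤
      ∫⁻ T, ENNReal.ofReal (Real.exp (t * supGhostDev H (glueSample (S, T))))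
        ∂(Measure.pi fun _ : Fin N × Fin 3 => P) := by
  have hN' : (0 : ℝ) < N := by exact_mod_cast hN
  let ν : Measure (Fin N × Fin 3 → Z × Fin V) := Measure.pi fun _ => P
  let Y : (Fin N × Fin 3 → Z × Fin V) → ℝ := fun T => t * ghostDev (glueSample (S, T)) h
  have hev : ∀ q : Fin N × Fin 3, MeasurePreserving (fun T : Fin N × Fin 3 → Z × Fin V => T q)
      ν P := fun q => measurePreserving_eval (fun _ => P) q
  have hl : ∀ q, Integrable (fun T : Fin N × Fin 3 → Z × Fin V =>
      l1Loss (h (T q).1) (T q).2) ν := fun q =>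
    (hev q).integrable_comp_of_integrable (integrable_l1Loss P hm)
  have hls : Integrable (fun T : Fin N × Fin 3 → Z × Fin V =>
      1 / (3 * N) * ∑ q, l1Loss (h (T q).1) (T q).2) ν :=
    (integrable_finsetSum _ fun q _ => hl q).const_mul _
  have hY : Integrable Y ν := by
    simp only [Y, ghostDev_glueSample]
    exact (hls.sub (integrable_const _)).const_mul t
  have hmean : ∫ T, Y T ∂ν = t * (risk P h - empRisk S h) := by
    simp only [Y, ghostDev_glueSample]
    rw [integral_const_mul, integral_sub hls (integrable_const _), integral_const_mul,
      integral_finsetSum _ fun q _ => hl q]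
    have : ∀ q : Fin N × Fin 3, ∫ T, l1Loss (h (T q).1) (T q).2 ∂ν = risk P h := fun q => by
      rw [risk, ← (hev q).map_eq, integral_map (hev q).aemeasurable
        (measurable_l1Loss hm).aestronglyMeasurable]
    simp only [this, integral_const, probReal_univ, one_smul, Finset.sum_const, Finset.card_univ,
      Fintype.card_prod, Fintype.card_fin, nsmul_eq_mul, Nat.cast_mul, Nat.cast_ofNat]
    congr 2
    field_simp
  have hbdd : ∀ T, Y T ≤ t * (2 * ∑ q, |ghostWeight N q|) := fun T => by
    refine mul_le_mul_of_nonneg_left (Finset.sum_le_sum (fun q _ => ?_) |>.trans_eq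
      (Finset.mul_sum _ _ _).symm) ht
    calc _ ≤ |ghostWeight N q| * l1Loss _ _ :=
          mul_le_mul_of_nonneg_right (le_abs_self _) (l1Loss_nonneg _ _)
      _ ≤ |ghostWeight N q| * 2 := mul_le_mul_of_nonneg_left (l1Loss_le_two _ _) (abs_nonneg _)
      _ = _ := mul_comm _ _
  have hexp : Integrable (fun T => Real.exp (Y T)) ν :=
    .of_bound (Real.continuous_exp.comp_aestronglyMeasurable hY.1)
      (Real.exp (t * (2 * ∑ q, |ghostWeight N q|))) (.of_forall fun T => by
        rw [Real.norm_eq_abs, Real.abs_exp]; exact Real.exp_le_exp.2 (hbdd T))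
  have hjensen := convexOn_exp.map_integral_le (μ := ν) (f := Y) Real.continuous_exp.continuousOn
    isClosed_univ (.of_forall fun _ => Set.mem_univ _) hY hexp
  rw [hmean] at hjensen
  calc _ ≤ ENNReal.ofReal (∫ T, Real.exp (Y T) ∂ν) := ENNReal.ofReal_le_ofReal hjensen
    _ = ∫⁻ T, ENNReal.ofReal (Real.exp (Y T)) ∂ν :=
      ofReal_integral_eq_lintegral_ofReal hexp (.of_forall fun _ => (Real.exp_pos _).le)
    _ ≤ _ := lintegral_mono fun T => ENNReal.ofReal_le_ofReal (Real.exp_le_exp.2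
      (mul_le_mul_of_nonneg_left ((le_abs_self _).trans (abs_ghostDev_le_supGhostDev _ hh)) ht))

/-! ### The Chernoff bound and the uniform deviation -/

/-- The arithmetic of the Chernoff bound at `t = 9 N ε / 16`. -/
theorem chernoff_growth_le {N V d : ℕ} (hN : 0 < N) (hV : 0 < V) {δ ε : ℝ} (hδ₀ : 0 < δ)
    (hδ₁ : δ < 1)
    (hε : ε = √(8 / (N : ℝ) * (2 * (d : ℝ) * Real.log √(2 * (N : ℝ) * (V : ℝ)) +
      Real.log (2 / δ)))) :
    2 * (4 * N * (V * (V - 1) : ℕ) + 1) ^ d * Real.exp (8 * (9 * N * ε / 16) ^ 2 / (9 * N)) ≤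
      δ * Real.exp (9 * N * ε / 16 * ε) := by
  have hN1 : (1 : ℝ) ≤ N := by exact_mod_cast hN
  have hV1 : (1 : ℝ) ≤ V := by exact_mod_cast hV
  have ha1 : (1 : ℝ) ≤ 2 * N * V := by nlinarith
  have ha0 : (0 : ℝ) < 2 * N * V := by linarith
  set X : ℝ := d * Real.log (2 * N * V) + Real.log (2 / δ) with hX
  have hX0 : 0 ≤ X := add_nonneg (mul_nonneg d.cast_nonneg (Real.log_nonneg ha1))
    (Real.log_nonneg ((one_le_div hδ₀).2 (by linarith)))
  have hε2 : N * ε ^ 2 = 8 * X := by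
    have : 2 * (d : ℝ) * Real.log √(2 * (N : ℝ) * (V : ℝ)) + Real.log (2 / δ) = X := by
      rw [Real.log_sqrt ha0.le, hX]; ring
    rw [hε, this, Real.sq_sqrt (by positivity)]
    field_simp
  have hexpX : Real.exp X = (2 * N * V) ^ d * (2 / δ) := by
    rw [hX, Real.exp_add, Real.exp_nat_mul, Real.exp_log ha0, Real.exp_log (by positivity)]
  -- This `t` minimizes `8t²/(9N) - tε`; the minimum is `-9Nε²/32 = -9/4 X`.
  have e1 : 8 * (9 * N * ε / 16) ^ 2 / (9 * N) = 9 / 4 * X := by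
    have : 8 * (9 * N * ε / 16) ^ 2 / (9 * N) = 9 / 32 * (N * ε ^ 2) := by field_simp; ring
    rw [this, hε2]; ring
  have e2 : 9 * N * ε / 16 * ε = 9 / 4 * X + 9 / 4 * X := by
    have : 9 * N * ε / 16 * ε = 9 / 16 * (N * ε ^ 2) := by ring
    rw [this, hε2]; ring
  have hgrowth : (4 * N * (V * (V - 1) : ℕ) + 1 : ℝ) ≤ (2 * N * V) ^ 2 := by
    rw [Nat.cast_mul, Nat.cast_sub hV, Nat.cast_one]
    have h1 : (V : ℝ) ≤ V * V * N := by
      calc (V : ℝ) = V * 1 * 1 := by ring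
        _ ≤ V * V * N := by gcongr
    have h2 : (V : ℝ) * V * N ≤ V * V * N * N := le_mul_of_one_le_right (by positivity) hN1
    nlinarith
  -- `exp (2X)` already contains `(2NV)^(2d)`, which absorbs the growth function, and `(2/δ)²`,
  -- which covers the remaining `2/δ`.
  have hle : 2 * (4 * N * (V * (V - 1) : ℕ) + 1 : ℝ) ^ d ≤ δ * Real.exp (9 / 4 * X) := by
    calc 2 * (4 * N * (V * (V - 1) : ℕ) + 1 : ℝ) ^ d ≤ 2 * ((2 * N * V) ^ 2) ^ d := by gcongr
      _ = δ ^ 2 / 2 * ((2 * N * V) ^ d * (2 / δ)) ^ 2 := by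
        rw [← pow_mul, mul_comm 2 d, pow_mul]
        field_simp
      _ ≤ δ * Real.exp X ^ 2 := by
        rw [hexpX]
        gcongr
        nlinarith
      _ ≤ δ * Real.exp (9 / 4 * X) := by
        rw [← Real.exp_nat_mul]
        gcongr
        norm_num
  rw [e1, e2, Real.exp_add, ← mul_assoc]
  gcongr

/-- Uniform deviation bound: the outer measure of the event that the risk of some member of the
class exceeds its empirical risk by more than the complexity term is at most `δ`. -/
theorem measure_exists_empRisk_add_lt_risk_le {Z : Type*} [MeasurableSpace Z] {V N d : ℕ}
    (hN : 0 < N) {H : Set (Z → Fin V)} (hmeas : ∀ h ∈ H, Measurable h)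
    (hdim : ∀ C, NatarajanShatters H C → C.card ≤ d) {P : Measure (Z × Fin V)}
    [IsProbabilityMeasure P] (hH : IsMeasurableClass P H) {δ : ℝ} (hδ₀ : 0 < δ) (hδ₁ : δ < 1) :
    (Measure.pi fun _ : Fin N => P) {S | ∃ h ∈ H, empRisk S h +
      √(8 / (N : ℝ) * (2 * (d : ℝ) * Real.log √(2 * (N : ℝ) * (V : ℝ)) + Real.log (2 / δ))) <
        risk P h} ≤ ENNReal.ofReal δ := by
  rcases H.eq_empty_or_nonempty with rfl | hne
  · simp
  set ε : ℝ := √(8 / (N : ℝ) * (2 * (d : ℝ) * Real.log √(2 * (N : ℝ) * (V : ℝ)) +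
    Real.log (2 / δ))) with hε
  have hV : 0 < V := by
    obtain ⟨p⟩ := nonempty_of_isProbabilityMeasure P
    exact p.2.pos
  set t : ℝ := 9 * N * ε / 16 with ht
  have ht0 : 0 ≤ t := by positivity
  let f : (Fin N × Fin 4 → Z × Fin V) → ENNReal := fun S =>
    ENNReal.ofReal (Real.exp (t * supGhostDev H S))
  have hf : AEMeasurable f (Measure.pi fun _ => P) :=
    (Real.measurable_exp.comp_aemeasurable
      ((aemeasurable_supGhostDev hH).const_mul t)).ennreal_ofReal
  have hmp := measurePreserving_glueSample P N
  have hf' : AEMeasurable (fun p => f (glueSample p))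
      ((Measure.pi fun _ : Fin N => P).prod (Measure.pi fun _ => P)) :=
    hf.comp_quasiMeasurePreserving hmp.quasiMeasurePreserving
  have hint : ∫⁻ S, ∫⁻ T, f (glueSample (S, T)) ∂(Measure.pi fun _ => P)
      ∂(Measure.pi fun _ : Fin N => P) ≤ ENNReal.ofReal (δ * Real.exp (t * ε)) := by
    rw [← lintegral_prod _ hf', ← lintegral_map' (by rwa [hmp.map_eq]) hmp.aemeasurable,
      hmp.map_eq]
    exact (lintegral_exp_supGhostDev_le hN hne hdim hH ht0).trans
      (ENNReal.ofReal_le_ofReal (chernoff_growth_le hN hV hδ₀ hδ₁ hε))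
  have hpos : ENNReal.ofReal (Real.exp (t * ε)) ≠ 0 := by simp [Real.exp_pos]
  -- Markov's inequality is applied to the ghost-averaged exponential as a function of `S`. The bad
  -- event only has to lie in its superlevel set, so its own measurability plays no role.
  refine (measure_mono ?_).trans ((meas_ge_le_lintegral_div hf'.lintegral_prod_right' hpos
    ENNReal.ofReal_ne_top).trans ((ENNReal.div_le_of_le_mul (hint.trans_eq
      (ENNReal.ofReal_mul hδ₀.le)))))
  rintro S ⟨h, hh, hS⟩
  refine le_trans (ENNReal.ofReal_le_ofReal (Real.exp_le_exp.2 ?_))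
    (exp_risk_sub_empRisk_le hN hh (hmeas h hh) S ht0)
  exact mul_le_mul_of_nonneg_left (by linarith) ht0

/-! ### The generalization bound -/

theorem isMeasurableClass_singleton {Z : Type*} [MeasurableSpace Z] {V : ℕ}
    (P : Measure (Z × Fin V)) {h : Z → Fin V} (hh : Measurable h) :
    IsMeasurableClass P {h} := by
  intro n e
  have hm : Measurable fun S : Fin n → Z × Fin V =>
      |∑ i, e i * l1Loss (h (S i).1) (S i).2| :=
    (Finset.measurable_sum _ fun i _ =>
      ((measurable_l1Loss hh).comp (measurable_pi_apply i)).const_mul (e i)).abs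
  convert hm.aemeasurable using 2 with S
  exact ciSup_unique

theorem NatarajanShatters.card_le {Z : Type*} {V d : ℕ} {H : Set (Z → Fin V)}
    (hdim : natarajanDim H = (d : ℕ∞)) {C : Finset Z} (hC : NatarajanShatters H C) :
    C.card ≤ d := by
  have : (C.card : ℕ∞) ≤ natarajanDim H :=
    le_iSup₂ (f := fun (C : Finset Z) (_ : NatarajanShatters H C) => (C.card : ℕ∞)) C hC
  rw [hdim] at this
  exact_mod_cast this

/-- The generalization bound holds outside a set of small outer measure, uniformly over a
measurable subclass. -/
theorem exists_measurableSet_risk_le_genBound {Z : Type*} [MeasurableSpace Z] {V N d : ℕ}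
    (hN : 0 < N) {H H' : Set (Z → Fin V)} (hsub : H' ⊆ H) (hmeas : ∀ h ∈ H, Measurable h)
    (hdim : natarajanDim H = (d : ℕ∞)) (PT PA : Measure (Z × Fin V)) [IsProbabilityMeasure PT]
    [IsProbabilityMeasure PA] (hclass : PA.map Prod.snd = PT.map Prod.snd)
    (hH' : IsMeasurableClass PT H') {δ : ℝ} (hδ₀ : 0 < δ) (hδ₁ : δ < 1) :
    ∃ E : Set (Fin N → Z × Fin V), MeasurableSet E ∧
      ENNReal.ofReal (1 - δ) ≤ (Measure.pi fun _ : Fin N => PT) E ∧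
      ∀ S ∈ E, ∀ h ∈ H', risk PA h ≤ genBound H d δ PA PT S h := by
  let μ : Measure (Fin N → Z × Fin V) := Measure.pi fun _ => PT
  let bad : Set (Fin N → Z × Fin V) := {S | ∃ h ∈ H', empRisk S h +
    √(8 / (N : ℝ) * (2 * (d : ℝ) * Real.log √(2 * (N : ℝ) * (V : ℝ)) + Real.log (2 / δ))) <
      risk PT h}
  have hbad : μ bad ≤ ENNReal.ofReal δ :=
    measure_exists_empRisk_add_lt_risk_le hN (fun h hh => hmeas h (hsub hh))
      (fun C hC => (hC.mono hsub).card_le hdim) hH' hδ₀ hδ₁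
  have hmb := measurableSet_toMeasurable μ bad
  -- The bad event may be non-measurable; its measurable hull has the same outer measure.
  refine ⟨(toMeasurable μ bad)ᶜ, hmb.compl, ?_, fun S hS h hh => ?_⟩
  · change _ ≤ μ _
    rw [prob_compl_eq_one_sub hmb, measure_toMeasurable, ENNReal.ofReal_sub _ hδ₀.le,
      ENNReal.ofReal_one]
    exact tsub_le_tsub_left hbad 1
  · have hT := not_lt.1 fun hlt => hS (subset_toMeasurable μ bad ⟨h, hh, hlt⟩)
    have hA := risk_le_risk_add_modalityDisc PT PA hclass (hsub hh) (hmeas h (hsub hh))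
    rw [genBound]
    linarith

theorem theorem3p1 {Z : Type*} [MeasurableSpace Z] {V N d : ℕ} (hN : 0 < N)
    (H : Set (Z → Fin V)) (hmeas : ∀ h ∈ H, Measurable h) (hdim : natarajanDim H = (d : ℕ∞))
    (PT PA : Measure (Z × Fin V)) [IsProbabilityMeasure PT] [IsProbabilityMeasure PA]
    (hclass : PA.map Prod.snd = PT.map Prod.snd)
    (δ : ℝ) (hδ₀ : 0 < δ) (hδ₁ : δ < 1) :
    (∀ h ∈ H, ENNReal.ofReal (1 - δ) ≤
      (Measure.pi fun _ : Fin N => PT) {S | risk PA h ≤ genBound H d δ PA PT S h}) ∧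
    (IsMeasurableClass PT H →
      ∃ E : Set (Fin N → Z × Fin V), MeasurableSet E ∧
        ENNReal.ofReal (1 - δ) ≤ (Measure.pi fun _ : Fin N => PT) E ∧
        ∀ S ∈ E, ∀ h ∈ H, risk PA h ≤ genBound H d δ PA PT S h) := by
  refine ⟨fun h hh => ?_, fun hH => exists_measurableSet_risk_le_genBound hN subset_rfl hmeas hdim
    PT PA hclass hH hδ₀ hδ₁⟩
  -- For a fixed `h`, the deviation bound is used for the class `{h}`, which is always measurable
  -- and shatters nothing that `H` does not; the bound keeps the `d` and discrepancy of `H`.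
  obtain ⟨E, -, hE, hbound⟩ := exists_measurableSet_risk_le_genBound hN
    (Set.singleton_subset_iff.2 hh) hmeas hdim PT PA hclass
    (isMeasurableClass_singleton PT (hmeas h hh)) hδ₀ hδ₁
  exact hE.trans (measure_mono fun S hS => hbound S hS h rfl)
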